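/- Let $\mathbb F=\mathbb R$ or $\mathbb C$, let $W\subset\mathbb F$, let $\mathcal B$ be a $\sigma$-algebra on $W$ containing the Borel sets of $W$, and let $\mu$ be a $\sigma$-finite measure on $(W,\mathcal B)$. Assume that there is $c:W\to\mathbb F$ with $|x-y|^2=c(x)c(y)(x-y)^2$ for all $x,y\in W$ (for instance $c=1$ if $W\subset\mathbb R$, and $c(x)=i/x$ if $W$ is the unit circle). Let $L$ be an even positive integer, $\beta=L^2$, let $1\le m\le M$ be integers, $M'=M-m$, $N'=LM'$, and let $w:W\to[0,\infty)$ be measurable with $$0<Z:=\frac1{M!}\int_{W^M}\prod_{j<k}|x_k-x_j|^\beta\prod_{\ell=1}^M w(x_\ell)\,d\mu^M(\mathbf x)<\infty .$$ The $\beta$-ensemble is the point process of $M$ particles in $W$ whose joint density with respect to $\mu^M$ is $$f(\mathbf x)=\frac1{M!\,Z}\prod_{j<k}|x_k-x_j|^\beta\prod_{\ell=1}^M w(x_\ell).$$ For $B\in\mathcal B$ let $N_B$ be the number of particles in $B$. An $m$-th correlation function is a measurable $R:W^m\to[0,\infty)$ such that $\mathbb E[N_{B_1}\cdots N_{B_m}]=\int_{B_1\times\cdots\times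 B_m}R\,d\mu^m$ for all pairwise disjoint $B_1,\dots,B_m\in\mathcal B$. Put $$R_m(\mathbf y)=\frac{M!}{M'!}\int_{W^{M'}}f(y_1,\dots,y_m,x_1,\dots,x_{M'})\,d\mu^{M'}(\mathbf x),\qquad u(x)=c(x)^{(M-1)\beta/2}\,w(x).$$ Let $p_0,\dots,p_{N'-1}\in\mathbb F[x]$ be any monic polynomials with $\deg p_n=n$. For $\mathfrak u=\{\mathfrak u(0)<\dots<\mathfrak u(L-1)\}\subset\{0,\dots,N'-1\}$ let $\mathrm{Wr}(\mathbf p_{\mathfrak u};x)=\det\big[\tfrac1{\ell!}p^{(\ell)}_{\mathfrak u(k)}(x)\big]_{\ell,k=0}^{L-1}$ and $\mathbf e_{\mathfrak u}=\mathbf e_{\mathfrak u(0)}\wedge\dots\wedge\mathbf e_{\mathfrak u(L-1)}$, where $\mathbf e_0,\dots,\mathbf e_{N'-1}$ is the standard basis of $\mathbb F^{N'}$. For $\omega\in\Lambda^L\mathbb F^{N'}$ let the hyperpfaffian $\mathrm{PF}(\omega)$ be the coefficient of $\mathbf e_0\wedge\dots\wedge\mathbf e_{N'-1}$ in $\omega^{\wedge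 M'}/M'!$. For $\mathbf y\in W^m$ let $$\gamma_{\mathbf y}=\sum_{\mathfrak u}\bigg(\int_W\prod_{j=1}^m(x-y_j)^\beta\;\mathrm{Wr}(\mathbf p_{\mathfrak u};x)\,u(x)\,d\mu(x)\bigg)\mathbf e_{\mathfrak u}\in\Lambda^L\mathbb F^{N'},$$ the sum being over all $L$-element subsets $\mathfrak u$ of $\{0,\dots,N'-1\}$. Then, for every $\mathbf y\in W^m$, the integrals defining $R_m(\mathbf y)$ and $\gamma_{\mathbf y}$ converge absolutely; $R_m$ is an $m$-th correlation function of the ensemble; and for every $\mathbf y\in W^m$ $$R_m(\mathbf y)=\frac1Z\prod_{1\le j<k\le m}(y_k-y_j)^\beta\cdot\prod_{n=1}^m u(y_n)\cdot\mathrm{PF}(\gamma_{\mathbf y}).$$ Moreover, every $m$-th correlation function of the ensemble is equal to the right-hand side at $\mu^m$-almost every $\mathbf y$ with pairwise distinct coordinates. -/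

import Mathlib

open MeasureTheory
open scoped ENNReal Nat

noncomputable section

/-! ### Point processes and correlation functions -/

open Classical in
/-- `N_B(x)`: the number of coordinates of `x ∈ X^M` that lie in `B`. -/
def occupation {X : Type*} {M : ℕ} (B : Set X) (x : Fin M → X) : ℕ :=
  (Finset.univ.filter fun i => x i ∈ B).card

/-- `R : X^m → [0, ∞)` is an `m`-th correlation function, with respect to the reference measure
`μ` on `X`, of the `M`-particle point process on `X` with law `P`: for pairwise disjoint measurable
sets `B_1, …, B_m`, the expectation of `N_{B_1} ⋯ N_{B_m}` is the integral of `R` with respect to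
`μ^m` over `B_1 × ⋯ × B_m`. -/
structure IsCorrelationFunction {X : Type*} [MeasurableSpace X] (μ : Measure X) {M : ℕ}
    (P : Measure (Fin M → X)) (m : ℕ) (R : (Fin m → X) → ℝ) : Prop where
  measurable : Measurable R
  nonneg : ∀ y, 0 ≤ R y
  expectation : ∀ B : Fin m → Set X, (∀ i, MeasurableSet (B i)) →
    (Pairwise fun i j => Disjoint (B i) (B j)) →
    ∫⁻ x, ∏ i, (occupation (B i) x : ℝ≥0∞) ∂P =
      ∫⁻ y in Set.univ.pi B, ENNReal.ofReal (R y) ∂(Measure.pi fun _ => μ)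

/-! ### β-ensembles -/

section Ensemble

variable {𝕜 : Type*} [RCLike 𝕜] {W : Set 𝕜}

/-- The unnormalized joint density
`∏_{j<k} |x_k - x_j|^β · ∏_l w(x_l)` of `M` particles in `W`. -/
def betaWeight (β : ℕ) (w : W → ℝ) {M : ℕ} (x : Fin M → W) : ℝ :=
  (∏ j, ∏ k ∈ Finset.Ioi j, ‖(x k : 𝕜) - (x j : 𝕜)‖ ^ β) * ∏ l, w (x l)

variable [MeasurableSpace W]

/-- The partition function `Z = (1/M!) ∫_{W^M} ∏_{j<k} |x_k - x_j|^β ∏_l w(x_l) dμ^M(x)`. -/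
def partitionFunction (β : ℕ) (w : W → ℝ) (μ : Measure W) (M : ℕ) : ℝ :=
  (M ! : ℝ)⁻¹ * ∫ x : Fin M → W, betaWeight β w x ∂(Measure.pi fun _ => μ)

/-- The joint density
`f(x) = (1 / (M! Z)) ∏_{j<k} |x_k - x_j|^β ∏_l w(x_l)` with respect to `μ^M`. -/
def jointDensity (β : ℕ) (w : W → ℝ) (μ : Measure W) {M : ℕ} (x : Fin M → W) : ℝ :=
  ((M ! : ℝ) * partitionFunction β w μ M)⁻¹ * betaWeight β w x

/-- The law on `W^M` of the `β`-ensemble of `M` particles with weight `w`. -/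
def betaEnsemble (β : ℕ) (w : W → ℝ) (μ : Measure W) (M : ℕ) : Measure (Fin M → W) :=
  (Measure.pi fun _ => μ).withDensity fun x => ENNReal.ofReal (jointDensity β w μ x)

/-- The `m`-th correlation function of the `β`-ensemble of `M = m + M'` particles as a marginal
density: `R_m(y) = (M! / M'!) ∫_{W^{M'}} f(y_1, …, y_m, x_1, …, x_{M'}) dμ^{M'}(x)`. -/
def betaCorrelation (β : ℕ) (w : W → ℝ) (μ : Measure W) (m M' : ℕ) (y : Fin m → W) : ℝ :=
  ((m + M')! : ℝ) / (M' ! : ℝ) *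
    ∫ x : Fin M' → W, jointDensity β w μ (Fin.append y x) ∂(Measure.pi fun _ => μ)

/-- The modified weight `u(x) = c(x)^{(M-1)β/2} w(x)` (used for `β` even and `M ≥ 1`). -/
def modifiedWeight (β M : ℕ) (c : W → 𝕜) (w : W → ℝ) (x : W) : 𝕜 :=
  c x ^ ((M - 1) * (β / 2)) * (w x : 𝕜)

end Ensemble

/-! ### Hyperpfaffians and Wronskians -/

section Hyperpfaffian

variable {𝕜 : Type*} [Field 𝕜]

/-- The Hodge star on the determinantal line of `Λ 𝕜^N`: the coefficient of
`e_0 ∧ ⋯ ∧ e_{N-1}` in the basis of the exterior algebra induced by the standard basis. -/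
def volumeCoeff {N : ℕ} (α : ExteriorAlgebra 𝕜 (Fin N → 𝕜)) : 𝕜 :=
  (Pi.basisFun 𝕜 (Fin N)).ExteriorAlgebra.repr α Finset.univ

/-- The hyperpfaffian `PF(ω) = ∗ (ω^{∧ M} / M!)` of an `L`-vector `ω ∈ Λ^L 𝕜^{LM}`. -/
def hyperpfaffian {L M : ℕ} (ω : ⋀[𝕜]^L (Fin (L * M) → 𝕜)) : 𝕜 :=
  volumeCoeff ((M ! : 𝕜)⁻¹ • (ω : ExteriorAlgebra 𝕜 (Fin (L * M) → 𝕜)) ^ M)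

/-- A complete family of monic polynomials: `p_n` is monic of degree `n` for `0 ≤ n < N`. -/
def IsCompleteMonicFamily {N : ℕ} (p : Fin N → Polynomial 𝕜) : Prop :=
  ∀ n, (p n).Monic ∧ (p n).natDegree = n

/-- The renormalized Wronskian `Wr(p_t; x) = det [D^ℓ p_{t(k)}(x)]_{ℓ,k=0}^{L-1}`, where
`t(0) < ⋯ < t(L-1)` are the elements of the `L`-subset `t` of `{0, …, N-1}` and
`D^ℓ = (1/ℓ!) d^ℓ/dx^ℓ` (the Hasse derivative). -/
def wronskian {N L : ℕ} (p : Fin N → Polynomial 𝕜) (t : Set.powersetCard (Fin N) L) (x : 𝕜) : 𝕜 :=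
  Matrix.det (Matrix.of fun ℓ k : Fin L =>
    (Polynomial.hasseDeriv ℓ (p (Set.powersetCard.ofFinEmbEquiv.symm t k))).eval x)

end Hyperpfaffian

/-! ### The `L`-vector `γ_y` -/

section Gram

variable {𝕜 : Type*} [RCLike 𝕜] {W : Set 𝕜}

/-- The integrand `∏_j (x - y_j)^β · Wr(p_t; x) · u(x)` of the coefficients of `γ_y`. -/
def gramIntegrand (β : ℕ) (u : W → 𝕜) {N L m : ℕ} (p : Fin N → Polynomial 𝕜) (y : Fin m → W)
    (t : Set.powersetCard (Fin N) L) (x : W) : 𝕜 :=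
  (∏ j, ((x : 𝕜) - (y j : 𝕜)) ^ β) * wronskian p t (x : 𝕜) * u x

/-- `γ_y = ∑_t (∫_W ∏_j (x - y_j)^β Wr(p_t; x) u(x) dμ(x)) e_t ∈ Λ^L 𝕜^N`, the sum being over
the `L`-subsets `t` of `{0, …, N-1}`. -/
def gramVector [MeasurableSpace W] (β : ℕ) (u : W → 𝕜) (μ : Measure W) {N m : ℕ} (L : ℕ)
    (p : Fin N → Polynomial 𝕜) (y : Fin m → W) : ⋀[𝕜]^L (Fin N → 𝕜) :=
  ∑ t : Set.powersetCard (Fin N) L,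
    (∫ x, gramIntegrand β u p y t x ∂μ) •
      exteriorPower.ιMulti_family 𝕜 L (Pi.basisFun 𝕜 (Fin N)) t

/-- The right-hand side
`(1/Z) ∏_{j<k} (y_k - y_j)^β · ∏_n u(y_n) · PF(γ_y)`, for `β = L^2` and `M = m + M'`
particles. -/
def hyperpfaffianCorrelation [MeasurableSpace W] (L : ℕ) (c : W → 𝕜) (w : W → ℝ) (μ : Measure W)
    (m M' : ℕ) (p : Fin (L * M') → Polynomial 𝕜) (y : Fin m → W) : 𝕜 :=
  ((partitionFunction (L ^ 2) w μ (m + M') : ℝ) : 𝕜)⁻¹ *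
    (∏ j, ∏ k ∈ Finset.Ioi j, ((y k : 𝕜) - (y j : 𝕜)) ^ (L ^ 2)) *
    (∏ n, modifiedWeight (L ^ 2) (m + M') c w (y n)) *
    hyperpfaffian (gramVector (L ^ 2) (modifiedWeight (L ^ 2) (m + M') c w) μ L p y)

end Gram

end

/-! Since `β` is even, the relation for `c` removes the absolute values: `|x_k - x_j|^β` is `(x_k -
x_j)^β` times a phase in each point. Every point lies in `M - 1` pairs, so the phases merge with `w`
into `u`. With `y` fixed, the pairs split into `y`-`y`, `y`-`x` and `x`-`x`.

The `x`-`x` part has exponent `L^2`, which makes it a confluent Vandermonde determinant with `L`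
rows per node (`det_confluentMatrix`). The rows of one node wedge to the `L`-vector `∑_t Wr(p_t; x)
e_t`, and the determinant is the volume coefficient of the product of these. Expanding multilinearly
and applying Fubini turns the integral into the coefficient of the power `γ_y^{M'}`
(`hyperpfaffian_sum_integral_wronskian`).

Convergence rests on one moment bound: `0 < Z < ∞` forces `(1 + |x|)^{β(M-1)} w` to be integrable
(`integrable_one_add_norm_pow_mul_weight`), and this order is exactly the growth of all integrands.

The marginal is a correlation function because the density is symmetric
(`lintegral_prod_occupation`). Uniqueness holds off the diagonals because countably many boxes with
disjoint sides cover the configurations of distinct points. -/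

noncomputable section

/-! ### Confluent Vandermonde determinants -/

section ConfluentVandermonde

open Polynomial Matrix

variable {K : Type*} [Field K]

/-- The index of the block of length `L` in which `i` lies. -/
def blockIndex {L n : ℕ} (i : Fin (L * n)) : Fin n :=
  ⟨(i : ℕ) / L, Nat.div_lt_of_lt_mul i.2⟩

/-- The confluent Vandermonde matrix `[D^ℓ p_j (x_k)]`, the row `i` standing for the pair
`(k, ℓ) = (i / L, i % L)`. -/
def confluentMatrix {L n : ℕ} (p : Fin (L * n) → K[X]) (x : Fin n → K) :
    Matrix (Fin (L * n)) (Fin (L * n)) K :=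
  Matrix.of fun i j => (hasseDeriv ((i : ℕ) % L) (p j)).eval (x (blockIndex i))

theorem confluentMatrix_eq_mul {L n : ℕ} (p : Fin (L * n) → K[X])
    (hp : ∀ j, (p j).natDegree ≤ j) (x : Fin n → K) :
    confluentMatrix p x = confluentMatrix (fun j => X ^ (j : ℕ)) x *
      Matrix.of (fun i j : Fin (L * n) => (p j).coeff i) := by
  ext i j
  rw [Matrix.mul_apply]
  simp only [confluentMatrix, Matrix.of_apply]
  conv_lhs => rw [(p j).as_sum_range' (L * n) (lt_of_le_of_lt (hp j) j.2)]
  rw [map_sum, eval_finsetSum, Finset.sum_range]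
  refine Finset.sum_congr rfl fun k _ => ?_
  rw [← C_mul_X_pow_eq_monomial, ← smul_eq_C_mul, map_smul, eval_smul, smul_eq_mul, mul_comm]

/-- The coefficient matrix of a complete monic family is unitriangular. The determinant thus does
not depend on the family, which may be chosen adapted to the nodes. -/
theorem det_confluentMatrix_eq_det_X_pow {L n : ℕ} {p : Fin (L * n) → K[X]}
    (hp : IsCompleteMonicFamily p) (x : Fin n → K) :
    (confluentMatrix p x).det =
      (confluentMatrix (fun j : Fin (L * n) => (X : K[X]) ^ (j : ℕ)) x).det := by
  rw [confluentMatrix_eq_mul p (fun j => (hp j).2.le), Matrix.det_mul,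
    Matrix.det_matrixOfPolynomials p (fun j => (hp j).2) (fun j => (hp j).1), mul_one]

/-- The Hermite interpolation basis attached to the nodes `x`, each of multiplicity `L`. -/
def hermiteBasis {L n : ℕ} (x : Fin n → K) (i : Fin (L * n)) : K[X] :=
  (∏ j ∈ Finset.Iio (blockIndex i), (X - C (x j)) ^ L) *
    (X - C (x (blockIndex i))) ^ ((i : ℕ) % L)

theorem isCompleteMonicFamily_hermiteBasis {L n : ℕ} (x : Fin n → K) :
    IsCompleteMonicFamily (hermiteBasis (L := L) x) := by
  intro i
  have h1 : (∏ j ∈ Finset.Iio (blockIndex i), (X - C (x j)) ^ L).Monic :=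
    monic_prod_of_monic _ _ fun j _ => (monic_X_sub_C _).pow _
  have h2 : ((X - C (x (blockIndex i))) ^ ((i : ℕ) % L)).Monic := (monic_X_sub_C _).pow _
  refine ⟨h1.mul h2, ?_⟩
  rw [hermiteBasis, h1.natDegree_mul h2,
    natDegree_prod_of_monic _ _ fun j _ => (monic_X_sub_C _).pow _]
  simp only [natDegree_pow, natDegree_X_sub_C, mul_one, Finset.sum_const, Fin.card_Iio, smul_eq_mul]
  exact Nat.div_add_mod' _ _

theorem eval_hasseDeriv_eq_zero_of_dvd {q : K[X]} {a : K} {r ℓ : ℕ} (h : (X - C a) ^ r ∣ q)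
    (hl : ℓ < r) : (hasseDeriv ℓ q).eval a = 0 := by
  obtain ⟨s, rfl⟩ := h
  rw [← taylor_coeff, taylor_mul, taylor_pow]
  simp only [map_sub, taylor_X, taylor_C, add_sub_cancel_right]
  rw [coeff_X_pow_mul', if_neg (by omega)]

theorem eval_hasseDeriv_mul_X_sub_C_pow (q : K[X]) (a : K) (r : ℕ) :
    (hasseDeriv r (q * (X - C a) ^ r)).eval a = q.eval a := by
  rw [← taylor_coeff, taylor_mul, taylor_pow]
  simp only [map_sub, taylor_X, taylor_C, add_sub_cancel_right]
  rw [coeff_mul_X_pow', if_pos le_rfl, Nat.sub_self, taylor_coeff_zero]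

theorem det_confluentMatrix_hermiteBasis {L n : ℕ} (x : Fin n → K) :
    (confluentMatrix (hermiteBasis (L := L) x) x).det =
      ∏ i : Fin (L * n), ∏ j ∈ Finset.Iio (blockIndex i), (x (blockIndex i) - x j) ^ L := by
  rw [Matrix.det_of_isLowerTriangular]
  · refine Finset.prod_congr rfl fun i _ => ?_
    rw [confluentMatrix, Matrix.of_apply, hermiteBasis, eval_hasseDeriv_mul_X_sub_C_pow, eval_prod]
    simp
  · intro i j hij
    have hij : i < j := hij
    have hL : 0 < L := Nat.pos_of_ne_zero fun h => by
      have := i.2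
      simp [h] at this
    rw [confluentMatrix, Matrix.of_apply]
    -- If `j` is in a later block, its polynomial contains the full factor `(X - x)^L` at the node
    -- of `i`; in the same block it vanishes there to order `j % L > i % L`.
    rcases (Nat.div_le_div_right (c := L) hij.le : (i : ℕ) / L ≤ (j : ℕ) / L).lt_or_eq with h | h
    · refine eval_hasseDeriv_eq_zero_of_dvd (r := L) ?_ (Nat.mod_lt _ hL)
      refine Dvd.dvd.mul_right ?_ _
      exact Finset.dvd_prod_of_mem (fun j => (X - C (x j)) ^ L) (Finset.mem_Iio.2 h)
    · have hnode : x (blockIndex i) = x (blockIndex j) := by simp [blockIndex, h]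
      refine eval_hasseDeriv_eq_zero_of_dvd (r := (j : ℕ) % L) ?_ ?_
      · rw [hnode]
        exact Dvd.intro_left _ rfl
      · have h1 := Nat.div_add_mod (i : ℕ) L
        have h2 := Nat.div_add_mod (j : ℕ) L
        rw [h] at h1
        have : (i : ℕ) < j := hij
        omega

theorem prod_blockIndex {L n : ℕ} {A : Type*} [CommMonoid A] (f : Fin n → A) :
    ∏ i : Fin (L * n), f (blockIndex i) = ∏ k, f k ^ L := by
  rw [← (finCongr (mul_comm n L)).prod_comp, ← finProdFinEquiv.prod_comp, Fintype.prod_prod_type]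
  refine Finset.prod_congr rfl fun k _ => ?_
  have h : ∀ l : Fin L, blockIndex (finCongr (mul_comm n L) (finProdFinEquiv (k, l))) = k := by
    intro l
    ext
    simp [blockIndex, finProdFinEquiv, Nat.add_mul_div_left, l.pos, Nat.div_eq_of_lt l.2]
  simp only [h, Finset.prod_const, Finset.card_univ, Fintype.card_fin]

/-- The confluent Vandermonde determinant. -/
theorem det_confluentMatrix {L n : ℕ} {p : Fin (L * n) → K[X]}
    (hp : IsCompleteMonicFamily p) (x : Fin n → K) :
    (confluentMatrix p x).det = ∏ j, ∏ k ∈ Finset.Ioi j, (x k - x j) ^ (L ^ 2) := by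
  rw [det_confluentMatrix_eq_det_X_pow hp,
    ← det_confluentMatrix_eq_det_X_pow (isCompleteMonicFamily_hermiteBasis x),
    det_confluentMatrix_hermiteBasis,
    prod_blockIndex fun k : Fin n => ∏ j ∈ Finset.Iio k, (x k - x j) ^ L]
  simp only [← Finset.prod_pow, ← pow_mul, ← sq]
  exact Finset.prod_comm' (by simp)

end ConfluentVandermonde

/-! ### Wedge products and determinants -/

section ExteriorAlgebra

variable {K : Type*} [Field K]

/-- An alternating `N`-form on an `N`-dimensional space is a multiple of the determinant; the
multiple is read off at the standard basis. -/
theorem volumeCoeff_ιMulti {N : ℕ} (v : Fin N → Fin N → K) :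
    volumeCoeff (ExteriorAlgebra.ιMulti K N v) = (Matrix.of v).det := by
  let b := Pi.basisFun K (Fin N)
  let ψ : (Fin N → K) [⋀^Fin N]→ₗ[K] K :=
    (b.ExteriorAlgebra.coord Finset.univ).compAlternatingMap (ExteriorAlgebra.ιMulti K N)
  have h1 : volumeCoeff (ExteriorAlgebra.ιMulti K N v) = ψ v := rfl
  have h2 : ψ b = 1 := by
    have hb : b.ExteriorAlgebra Finset.univ = ExteriorAlgebra.ιMulti K N b := by
      have hid : ⇑(Set.powersetCard.ofFinEmbEquiv.symm
          (Set.powersetCard.ofCard (s := (Finset.univ : Finset (Fin N))) (n := N) (by simp))) =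
          id :=
        (Finset.orderEmbOfFin_unique (s := Finset.univ) (by simp) (f := id) (by simp)
          strictMono_id).symm
      rw [ExteriorAlgebra.basis_apply_ofCard b (n := N) (by simp), ExteriorAlgebra.ιMulti_family,
        hid, Function.comp_id]
    change b.ExteriorAlgebra.repr (ExteriorAlgebra.ιMulti K N b) Finset.univ = 1
    rw [← hb, Module.Basis.repr_self, Finsupp.single_eq_same]
  rw [h1, ψ.eq_smul_basis_det b, h2, one_smul, Module.Basis.det_apply, ← Matrix.det_transpose]
  rfl

theorem ιMulti_eq_sum_det_smul {N L : ℕ} (v : Fin L → Fin N → K) :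
    exteriorPower.ιMulti K L v = ∑ t : Set.powersetCard (Fin N) L,
      (Matrix.of fun i j => v i (Set.powersetCard.ofFinEmbEquiv.symm t j)).det •
        exteriorPower.ιMulti_family K L (Pi.basisFun K (Fin N)) t := by
  conv_lhs => rw [← ((Pi.basisFun K (Fin N)).exteriorPower L).sum_repr (exteriorPower.ιMulti K L v)]
  refine Finset.sum_congr rfl fun t _ => ?_
  rw [exteriorPower.basis_repr_apply, exteriorPower.ιMultiDual_apply_ιMulti,
    exteriorPower.basis_apply]
  rfl

theorem prod_ofFn_ιMulti {V : Type*} [AddCommGroup V] [Module K V] {L n : ℕ}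
    (v : Fin n → Fin L → V) :
    (List.ofFn fun k => ExteriorAlgebra.ιMulti K L (v k)).prod =
      ExteriorAlgebra.ιMulti K (L * n) fun i => v (blockIndex i)
        ⟨(i : ℕ) % L, Nat.mod_lt _ (Nat.pos_of_mul_pos_right (Nat.zero_lt_of_lt i.2))⟩ := by
  simp only [ExteriorAlgebra.ιMulti_apply]
  rw [List.ofFn_mul', List.prod_flatten, List.map_ofFn]
  congr 2
  funext k
  simp only [Function.comp_apply]
  congr 2
  funext l
  congr 2
  · ext; simp [blockIndex, Nat.mul_add_div l.pos, Nat.div_eq_of_lt l.2]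
  · ext; simp [Nat.mod_eq_of_lt l.2]

/-- The decomposable `L`-vector `∑_t Wr(p_t; x) e_t`. -/
theorem sum_wronskian_smul {N L : ℕ} (p : Fin N → Polynomial K) (x : K) :
    ∑ t : Set.powersetCard (Fin N) L,
      wronskian p t x • exteriorPower.ιMulti_family K L (Pi.basisFun K (Fin N)) t =
    exteriorPower.ιMulti K L fun ℓ n => (Polynomial.hasseDeriv (ℓ : ℕ) (p n)).eval x := by
  rw [ιMulti_eq_sum_det_smul]
  rfl

/-- A Laplace expansion by blocks of `L` rows: each factor is the wedge of the rows of one node, so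
the product is the wedge of all rows of the confluent matrix. -/
theorem volumeCoeff_prod_sum_wronskian {L n : ℕ} {p : Fin (L * n) → Polynomial K}
    (hp : IsCompleteMonicFamily p) (x : Fin n → K) :
    volumeCoeff (List.ofFn fun k => ∑ t : Set.powersetCard (Fin (L * n)) L, wronskian p t (x k) •
      (exteriorPower.ιMulti_family K L (Pi.basisFun K (Fin (L * n))) t :
        ExteriorAlgebra K (Fin (L * n) → K))).prod =
    ∏ j, ∏ k ∈ Finset.Ioi j, (x k - x j) ^ (L ^ 2) := by
  have h : ∀ k, ∑ t : Set.powersetCard (Fin (L * n)) L, wronskian p t (x k) •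
      (exteriorPower.ιMulti_family K L (Pi.basisFun K (Fin (L * n))) t :
        ExteriorAlgebra K (Fin (L * n) → K)) = ExteriorAlgebra.ιMulti K L
          fun ℓ n => (Polynomial.hasseDeriv (ℓ : ℕ) (p n)).eval (x k) := by
    intro k
    have := congrArg Subtype.val (sum_wronskian_smul (L := L) p (x k))
    simpa using this
  simp only [h]
  rw [prod_ofFn_ιMulti, volumeCoeff_ιMulti, ← det_confluentMatrix hp]
  rfl

end ExteriorAlgebra

/-! ### De Bruijn's identity -/

section DeBruijn

theorem volumeCoeff_prod_ofFn_sum {K ι : Type*} [Field K] [Fintype ι] {N n : ℕ}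
    (a : Fin n → ι → K) (e : ι → ExteriorAlgebra K (Fin N → K)) :
    volumeCoeff (List.ofFn fun k => ∑ t, a k t • e t).prod =
      ∑ r : Fin n → ι, (∏ k, a k (r k)) * volumeCoeff (List.ofFn fun k => e (r k)).prod := by
  classical
  let ψ : ExteriorAlgebra K (Fin N → K) →ₗ[K] K :=
    (Pi.basisFun K (Fin N)).ExteriorAlgebra.coord Finset.univ
  change ψ _ = ∑ r : Fin n → ι, (∏ k, a k (r k)) * ψ _
  have h := (MultilinearMap.mkPiAlgebraFin K n (ExteriorAlgebra K (Fin N → K))).map_sum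
    (fun k t => a k t • e t)
  simp only [MultilinearMap.map_smul_univ, MultilinearMap.mkPiAlgebraFin_apply] at h
  rw [h, map_sum]
  simp only [map_smul, smul_eq_mul]

variable {𝕜 : Type*} [RCLike 𝕜]

/-- De Bruijn's identity: the hyperpfaffian of the `L`-vector of moments of the Wronskians is a
multiple integral of a power of the Vandermonde product. -/
theorem hyperpfaffian_sum_integral_wronskian {X : Type*} [MeasurableSpace X] (μ : Measure X)
    [SigmaFinite μ] {L n : ℕ} {p : Fin (L * n) → Polynomial 𝕜} (hp : IsCompleteMonicFamily p)
    (ξ g : X → 𝕜)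
    (hint : ∀ t : Set.powersetCard (Fin (L * n)) L,
      Integrable (fun x => g x * wronskian p t (ξ x)) μ) :
    hyperpfaffian (∑ t : Set.powersetCard (Fin (L * n)) L,
      (∫ x, g x * wronskian p t (ξ x) ∂μ) •
        exteriorPower.ιMulti_family 𝕜 L (Pi.basisFun 𝕜 (Fin (L * n))) t) =
    (n ! : 𝕜)⁻¹ * ∫ x : Fin n → X, (∏ k, g (x k)) *
      ∏ j, ∏ k ∈ Finset.Ioi j, (ξ (x k) - ξ (x j)) ^ (L ^ 2) ∂(Measure.pi fun _ => μ) := by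
  let e : Set.powersetCard (Fin (L * n)) L → ExteriorAlgebra 𝕜 (Fin (L * n) → 𝕜) := fun t =>
    exteriorPower.ιMulti_family 𝕜 L (Pi.basisFun 𝕜 (Fin (L * n))) t
  have hvc : ∀ x : Fin n → X, (∏ k, g (x k)) *
      ∏ j, ∏ k ∈ Finset.Ioi j, (ξ (x k) - ξ (x j)) ^ (L ^ 2) =
      ∑ r : Fin n → Set.powersetCard (Fin (L * n)) L,
        (∏ k, (g (x k) * wronskian p (r k) (ξ (x k)))) *
          volumeCoeff (List.ofFn fun k => e (r k)).prod := by
    intro x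
    rw [← volumeCoeff_prod_sum_wronskian hp (fun k => ξ (x k)), volumeCoeff_prod_ofFn_sum,
      Finset.mul_sum]
    refine Finset.sum_congr rfl fun r _ => ?_
    rw [Finset.prod_mul_distrib, mul_assoc]
  have hterm : ∀ r : Fin n → Set.powersetCard (Fin (L * n)) L, Integrable (fun x : Fin n → X =>
      (∏ k, (g (x k) * wronskian p (r k) (ξ (x k)))) *
        volumeCoeff (List.ofFn fun k => e (r k)).prod) (Measure.pi fun _ => μ) := fun r =>
    (Integrable.fintype_prod (f := fun k x => g x * wronskian p (r k) (ξ x))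
      fun k => hint (r k)).mul_const _
  simp only [hvc]
  rw [integral_finsetSum _ fun r _ => hterm r]
  have hsmul : ∀ (a : 𝕜) (α : ExteriorAlgebra 𝕜 (Fin (L * n) → 𝕜)),
      volumeCoeff (a • α) = a * volumeCoeff α := fun a α => by simp [volumeCoeff]
  rw [hyperpfaffian, hsmul]
  congr 1
  -- The same expansion with all `n` factors equal to the moment vector, hence of its `n`-th power;
  -- Fubini then matches it term by term.
  have hpow := volumeCoeff_prod_ofFn_sum (n := n)
    (fun _ t => ∫ x, g x * wronskian p t (ξ x) ∂μ) e
  rw [List.ofFn_const, List.prod_replicate] at hpow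
  rw [AddSubmonoidClass.coe_finsetSum]
  refine hpow.trans (Finset.sum_congr rfl fun r _ => ?_)
  rw [integral_mul_const,
    integral_fintype_prod_eq_prod (fun k x => g x * wronskian p (r k) (ξ x))]

end DeBruijn

/-! ### Degree of the Wronskians -/

section WronskianGrowth

open Polynomial

theorem exists_wronskian_eq_eval {K : Type*} [Field K] {N L : ℕ} {p : Fin N → K[X]}
    (hp : ∀ n, (p n).natDegree ≤ n) (t : Set.powersetCard (Fin N) L) :
    ∃ q : K[X], q.natDegree ≤ L * (N - L) ∧ ∀ x, wronskian p t x = q.eval x := by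
  set s := Set.powersetCard.ofFinEmbEquiv.symm t with hs
  refine ⟨Matrix.det (Matrix.of fun ℓ k : Fin L => hasseDeriv (ℓ : ℕ) (p (s k))), ?_, fun x => ?_⟩
  · have hLN : L ≤ N := by simpa using Fintype.card_le_of_injective s s.injective
    -- `s` is increasing, so at least `L - 1 - k` elements of `Fin N` lie above `s k`.
    have hsk : ∀ k : Fin L, (s k : ℕ) ≤ (N - L) + k := by
      intro k
      have h := Finset.card_le_card_of_injOn (s := Finset.Ioi k) (t := Finset.Ioi (s k)) s
        (fun j hj => by simpa using hj) s.injective.injOn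
      rw [Fin.card_Ioi, Fin.card_Ioi] at h
      have := k.2
      have := (s k).2
      omega
    rw [Matrix.det_apply]
    refine natDegree_sum_le_of_forall_le _ _ fun σ _ => ?_
    refine (natDegree_smul_le _ _).trans ?_
    -- Column `k` loses degree `σ k`, and the sum of the `σ k` is that of the `k`, leaving `L * (N -
    -- L)`. If some `σ k` exceeds `s k`, truncated subtraction breaks this count, but the term
    -- vanishes.
    by_cases h : ∀ k : Fin L, (σ k : ℕ) ≤ s k
    · refine (natDegree_prod_le _ _).trans ?_
      have h1 : ∑ k : Fin L, (((s k : ℕ) - σ k) + σ k) ≤ ∑ k : Fin L, ((N - L) + (k : ℕ)) :=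
        Finset.sum_le_sum fun k _ => by rw [Nat.sub_add_cancel (h k)]; exact hsk k
      rw [Finset.sum_add_distrib, Finset.sum_add_distrib,
        Equiv.sum_comp σ (fun k : Fin L => (k : ℕ))] at h1
      have h2 : ∑ k : Fin L, (hasseDeriv (σ k : ℕ) (p (s k))).natDegree ≤
          ∑ k : Fin L, ((s k : ℕ) - σ k) := Finset.sum_le_sum fun k _ =>
        (natDegree_hasseDeriv_le _ _).trans (Nat.sub_le_sub_right (hp _) _)
      simp only [Finset.sum_const, Finset.card_univ, Fintype.card_fin, smul_eq_mul] at h1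
      simp only [Matrix.of_apply]
      omega
    · push Not at h
      obtain ⟨k, hk⟩ := h
      rw [Finset.prod_eq_zero (Finset.mem_univ k)]
      · simp
      · rw [Matrix.of_apply]
        exact hasseDeriv_eq_zero_of_lt_natDegree _ _ ((hp _).trans_lt hk)
  · rw [_root_.wronskian, ← coe_evalRingHom, RingHom.map_det]
    rfl

theorem exists_norm_eval_le {𝕜 : Type*} [RCLike 𝕜] {q : 𝕜[X]} {d : ℕ} (hq : q.natDegree ≤ d) :
    ∃ C : ℝ, 0 ≤ C ∧ ∀ x : 𝕜, ‖q.eval x‖ ≤ C * (1 + ‖x‖) ^ d := by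
  refine ⟨∑ i ∈ Finset.range (q.natDegree + 1), ‖q.coeff i‖, by positivity, fun x => ?_⟩
  rw [eval_eq_sum_range, Finset.sum_mul]
  refine (norm_sum_le _ _).trans (Finset.sum_le_sum fun i hi => ?_)
  rw [norm_mul, norm_pow]
  have h1 : ‖x‖ ^ i ≤ (1 + ‖x‖) ^ i := by gcongr; linarith
  have h2 : (1 + ‖x‖) ^ i ≤ (1 + ‖x‖) ^ d :=
    pow_le_pow_right₀ (by linarith [norm_nonneg x]) (by rw [Finset.mem_range] at hi; omega)
  gcongr
  exact h1.trans h2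

end WronskianGrowth

/-! ### Products over pairs of indices -/

section PairProducts

theorem prod_Ioi_mul_eq_prod_pow {A : Type*} [CommMonoid A] {n : ℕ} (a : Fin n → A) :
    ∏ j, ∏ k ∈ Finset.Ioi j, (a j * a k) = ∏ j, a j ^ (n - 1) := by
  have h : ∏ j, ∏ k ∈ Finset.Ioi j, a k = ∏ k, ∏ j ∈ Finset.Iio k, a k :=
    Finset.prod_comm' (by simp)
  simp only [Finset.prod_mul_distrib]
  rw [h, ← Finset.prod_mul_distrib]
  refine Finset.prod_congr rfl fun j _ => ?_
  rw [Finset.prod_const, Finset.prod_const, Fin.card_Ioi, Fin.card_Iio, ← pow_add]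
  congr 1
  omega

theorem prod_Ioi_append {A α : Type*} [CommMonoid A] {m n : ℕ} (F : α → α → A) (y : Fin m → α)
    (x : Fin n → α) :
    ∏ j, ∏ k ∈ Finset.Ioi j, F (Fin.append y x j) (Fin.append y x k) =
      (∏ j, ∏ k ∈ Finset.Ioi j, F (y j) (y k)) * (∏ l, ∏ j, F (y j) (x l)) *
        ∏ j, ∏ k ∈ Finset.Ioi j, F (x j) (x k) := by
  have hIoi : ∀ {n : ℕ} (j : Fin n) (G : Fin n → A),
      ∏ k ∈ Finset.Ioi j, G k = ∏ k, if j < k then G k else 1 := by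
    intro n j G
    rw [← Finset.prod_filter]
    congr 1
    ext
    simp
  simp only [hIoi, Fin.prod_univ_add, Fin.append_left, Fin.append_right]
  have h1 : ∀ (i : Fin m) (k : Fin n), Fin.castAdd n i < Fin.natAdd m k := fun i k => by
    simp only [Fin.lt_def, Fin.val_castAdd, Fin.val_natAdd]; omega
  have h2 : ∀ (i : Fin n) (k : Fin m), ¬ Fin.natAdd m i < Fin.castAdd n k := fun i k => by
    simp only [Fin.lt_def, Fin.val_castAdd, Fin.val_natAdd]; omega
  have h3 : ∀ i k : Fin m, Fin.castAdd n i < Fin.castAdd n k ↔ i < k := fun i k => by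
    simp only [Fin.lt_def, Fin.val_castAdd]
  have h4 : ∀ i k : Fin n, Fin.natAdd m i < Fin.natAdd m k ↔ i < k := fun i k => by
    simp only [Fin.lt_def, Fin.val_natAdd]; omega
  simp only [h1, h2, h3, h4, if_true, if_false, Finset.prod_mul_distrib, Finset.prod_const_one,
    one_mul]
  rw [Finset.prod_comm (f := fun i k => F (y i) (x k))]

end PairProducts

/-! ### The joint weight and the moments of `w` -/

section BetaWeight

variable {𝕜 : Type*} [RCLike 𝕜] {W : Set 𝕜}

theorem betaWeight_eq_norm_det (β : ℕ) (w : W → ℝ) {M : ℕ} (x : Fin M → W) :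
    betaWeight β w x =
      ‖(Matrix.vandermonde fun i => (x i : 𝕜)).det‖ ^ β * ∏ l, w (x l) := by
  rw [betaWeight, Matrix.det_vandermonde]
  simp only [norm_prod, Finset.prod_pow]

theorem betaWeight_comp_perm (β : ℕ) (w : W → ℝ) {M : ℕ} (x : Fin M → W)
    (σ : Equiv.Perm (Fin M)) : betaWeight β w (x ∘ σ) = betaWeight β w x := by
  rw [betaWeight_eq_norm_det, betaWeight_eq_norm_det]
  congr 1
  · have h : (Matrix.vandermonde fun i => ((x ∘ σ) i : 𝕜)) =
        (Matrix.vandermonde fun i => (x i : 𝕜)).submatrix σ id := by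
      ext; simp [Matrix.vandermonde_apply]
    rw [h, Matrix.det_permute]
    rcases Int.units_eq_one_or (Equiv.Perm.sign σ) with h | h <;> simp [h]
  · exact Equiv.prod_comp σ fun l => w (x l)

theorem betaWeight_ne_zero_iff {β : ℕ} (hβ : β ≠ 0) (w : W → ℝ) {M : ℕ} (x : Fin M → W) :
    betaWeight β w x ≠ 0 ↔ Function.Injective x ∧ ∀ l, w (x l) ≠ 0 := by
  rw [betaWeight_eq_norm_det, mul_ne_zero_iff, pow_ne_zero_iff hβ, norm_ne_zero_iff,
    Matrix.det_vandermonde_ne_zero_iff, Finset.prod_ne_zero_iff]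
  simp only [Finset.mem_univ, true_imp_iff]
  exact and_congr_left fun _ => Subtype.val_injective.of_comp_iff x

theorem betaWeight_nonneg (β : ℕ) {w : W → ℝ} (hw0 : ∀ x, 0 ≤ w x) {M : ℕ} (x : Fin M → W) :
    0 ≤ betaWeight β w x :=
  mul_nonneg (Finset.prod_nonneg fun _ _ => Finset.prod_nonneg fun _ _ => by positivity)
    (Finset.prod_nonneg fun _ _ => hw0 _)

theorem betaWeight_cons (β : ℕ) (w : W → ℝ) {n : ℕ} (a : W) (z : Fin n → W) :
    betaWeight β w (Fin.cons a z : Fin (n + 1) → W) =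
      (∏ j, ‖(a : 𝕜) - z j‖ ^ β) * w a * betaWeight β w z := by
  simp only [betaWeight, Fin.prod_univ_succ, Fin.prod_Ioi_zero, Fin.prod_Ioi_succ, Fin.cons_zero,
    Fin.cons_succ, norm_sub_rev (z _ : 𝕜) (a : 𝕜)]
  ring

theorem norm_sub_le_one_add_mul (a b : 𝕜) : ‖a - b‖ ≤ (1 + ‖b‖) * (1 + ‖a‖) := by
  have := norm_sub_le a b
  nlinarith [norm_nonneg a, norm_nonneg b]

theorem betaWeight_le_prod (β : ℕ) {w : W → ℝ} (hw0 : ∀ x, 0 ≤ w x) {M : ℕ} (x : Fin M → W) :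
    betaWeight β w x ≤ ∏ l, ((1 + ‖(x l : 𝕜)‖) ^ (β * (M - 1)) * w (x l)) := by
  rw [Finset.prod_mul_distrib, betaWeight]
  refine mul_le_mul_of_nonneg_right ?_ (Finset.prod_nonneg fun _ _ => hw0 _)
  simp only [pow_mul]
  rw [← prod_Ioi_mul_eq_prod_pow fun l => (1 + ‖(x l : 𝕜)‖) ^ β]
  refine Finset.prod_le_prod (fun _ _ => Finset.prod_nonneg fun _ _ => by positivity) fun j _ => ?_
  refine Finset.prod_le_prod (fun _ _ => by positivity) fun k _ => ?_
  rw [← mul_pow]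
  exact pow_le_pow_left₀ (norm_nonneg _) (norm_sub_le_one_add_mul _ _) _

/-- Omit the node nearest to `t`. Every other node is at distance at least half its distance to the
omitted one, so `1 + ‖t‖` is at most a constant times `‖t - x j‖`. -/
theorem one_add_norm_pow_le_sum {n : ℕ} (β : ℕ) {x : Fin (n + 1) → 𝕜} (hx : Function.Injective x) :
    ∃ C : ℝ, ∀ t : 𝕜, (1 + ‖t‖) ^ (β * n) ≤
      C * ∑ i : Fin (n + 1), ∏ j : Fin n, ‖t - x (i.succAbove j)‖ ^ β := by
  set K : ℝ := 1 + ∑ i, ∑ j, (1 + ‖x j‖) * (2 / ‖x j - x i‖) with hK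
  have hK0 : 0 ≤ K := by positivity
  refine ⟨K ^ (β * n), fun t => ?_⟩
  obtain ⟨i, -, hi⟩ := Finset.exists_min_image Finset.univ (fun i => ‖t - x i‖)
    ⟨0, Finset.mem_univ _⟩
  have key : ∀ j, j ≠ i → 1 + ‖t‖ ≤ K * ‖t - x j‖ := by
    intro j hj
    have hpos : 0 < ‖x j - x i‖ := norm_pos_iff.2 (sub_ne_zero.2 (hx.ne hj))
    have h1 : ‖x j - x i‖ ≤ 2 * ‖t - x j‖ := by
      have h2 := hi j (Finset.mem_univ _)
      have h3 : ‖x j - x i‖ ≤ ‖t - x i‖ + ‖t - x j‖ := by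
        have := norm_sub_le (t - x i) (t - x j)
        simpa using this
      linarith
    have h4 : (1 : ℝ) ≤ 2 / ‖x j - x i‖ * ‖t - x j‖ := by
      rw [div_mul_eq_mul_div, le_div_iff₀ hpos]; linarith
    have h5 : (1 + ‖x j‖) * (2 / ‖x j - x i‖) ≤
        ∑ i, ∑ j, (1 + ‖x j‖) * (2 / ‖x j - x i‖) :=
      (Finset.single_le_sum (f := fun j => (1 + ‖x j‖) * (2 / ‖x j - x i‖))
        (fun _ _ => by positivity) (Finset.mem_univ j)).trans
      (Finset.single_le_sum (f := fun i => ∑ j, (1 + ‖x j‖) * (2 / ‖x j - x i‖))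
        (fun _ _ => by positivity) (Finset.mem_univ i))
    have h6 : ‖t‖ ≤ ‖t - x j‖ + ‖x j‖ := by simpa using norm_add_le (t - x j) (x j)
    have h7 : 1 + ‖x j‖ ≤ (1 + ‖x j‖) * (2 / ‖x j - x i‖) * ‖t - x j‖ := by
      rw [mul_assoc]
      exact le_mul_of_one_le_right (by positivity) h4
    have h8 := mul_le_mul_of_nonneg_right h5 (norm_nonneg (t - x j))
    rw [hK, add_mul]
    linarith
  have h1 : (1 + ‖t‖) ^ (β * n) ≤ K ^ (β * n) * ∏ j : Fin n, ‖t - x (i.succAbove j)‖ ^ β := by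
    have h : ∏ j : Fin n, (1 + ‖t‖) ^ β ≤ ∏ j : Fin n, (K * ‖t - x (i.succAbove j)‖) ^ β :=
      Finset.prod_le_prod (fun _ _ => by positivity) fun j _ =>
        pow_le_pow_left₀ (by positivity) (key _ (Fin.succAbove_ne i j)) _
    simpa only [mul_pow, Finset.prod_mul_distrib, Finset.prod_const, Finset.card_univ,
      Fintype.card_fin, ← pow_mul] using h
  refine h1.trans (mul_le_mul_of_nonneg_left ?_ (by positivity))
  exact Finset.single_le_sum
    (f := fun i : Fin (n + 1) => ∏ j : Fin n, ‖t - x (i.succAbove j)‖ ^ β)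
    (fun _ _ => Finset.prod_nonneg fun _ _ => by positivity) (Finset.mem_univ i)

variable [MeasurableSpace W]

theorem measurable_betaWeight (hW : @Measurable W 𝕜 _ (borel 𝕜) Subtype.val) (β : ℕ) {w : W → ℝ}
    (hw : Measurable w) (M : ℕ) : Measurable fun x : Fin M → W => betaWeight β w x := by
  have hv : ∀ i : Fin M, Measurable fun x : Fin M → W => (x i : 𝕜) := fun i =>
    Measurable.comp (g := (Subtype.val : W → 𝕜)) hW (measurable_pi_apply i)
  refine Measurable.mul ?_ ?_
  · refine Finset.measurable_prod _ fun j _ => Finset.measurable_prod _ fun k _ => ?_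
    exact ((hv k).sub (hv j)).norm.pow_const β
  · exact Finset.measurable_prod _ fun l _ => hw.comp (measurable_pi_apply l)

/-- Integrability of the joint weight gives that of `∏_j |a - z_j|^β w(a)` in one particle, for
almost every position `z` of the others. Finitely many such products, built from `M` distinct nodes,
dominate the wanted power. -/
theorem integrable_one_add_norm_pow_mul_weight
    (hW : @Measurable W 𝕜 _ (borel 𝕜) Subtype.val) (μ : Measure W) [SigmaFinite μ]
    {β : ℕ} (hβ : β ≠ 0) {w : W → ℝ} (hw : Measurable w) (hw0 : ∀ x, 0 ≤ w x) {M : ℕ} (hM : 1 ≤ M)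
    (hint : Integrable (fun x : Fin M → W => betaWeight β w x) (Measure.pi fun _ => μ))
    (hpos : 0 < ∫ x : Fin M → W, betaWeight β w x ∂(Measure.pi fun _ => μ)) :
    Integrable (fun x : W => (1 + ‖(x : 𝕜)‖) ^ (β * (M - 1)) * w x) μ := by
  obtain ⟨n, rfl⟩ : ∃ n, M = n + 1 := ⟨M - 1, by omega⟩
  rw [Nat.add_sub_cancel]
  have hprod : Integrable (fun q : W × (Fin n → W) => betaWeight β w (Fin.cons q.1 q.2 :
      Fin (n + 1) → W)) (μ.prod (Measure.pi fun _ => μ)) := by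
    have h := (measurePreserving_piFinSuccAbove (fun _ : Fin (n + 1) => μ) 0).symm
    refine ((h.integrable_comp_emb (MeasurableEquiv.measurableEmbedding _)).2 hint).congr
      (Filter.Eventually.of_forall fun q => congrArg (betaWeight β w) ?_)
    exact Fin.insertNth_zero' q.1 q.2
  have hgood : ∀ᵐ z ∂(Measure.pi fun _ : Fin n => μ), betaWeight β w z ≠ 0 →
      Integrable (fun a : W => (∏ j, ‖(a : 𝕜) - z j‖ ^ β) * w a) μ := by
    filter_upwards [hprod.prod_left_ae] with z hz hne
    have := hz.mul_const (betaWeight β w z)⁻¹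
    refine this.congr (Filter.Eventually.of_forall fun a => ?_)
    simp only [betaWeight_cons]
    rw [mul_assoc, mul_inv_cancel₀ hne, mul_one]
  have hall : ∀ᵐ x ∂(Measure.pi fun _ : Fin (n + 1) => μ), ∀ i : Fin (n + 1),
      betaWeight β w (fun j => x (i.succAbove j)) ≠ 0 →
      Integrable (fun a : W => (∏ j, ‖(a : 𝕜) - x (i.succAbove j)‖ ^ β) * w a) μ := by
    refine ae_all_iff.2 fun i => ?_
    exact (Measure.quasiMeasurePreserving_snd.comp
      (measurePreserving_piFinSuccAbove (fun _ : Fin (n + 1) => μ) i).quasiMeasurePreserving).ae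
      hgood
  obtain ⟨x, hx0, hx⟩ : ∃ x : Fin (n + 1) → W, betaWeight β w x ≠ 0 ∧ ∀ i : Fin (n + 1),
      betaWeight β w (fun j => x (i.succAbove j)) ≠ 0 →
      Integrable (fun a : W => (∏ j, ‖(a : 𝕜) - x (i.succAbove j)‖ ^ β) * w a) μ := by
    -- Without such a configuration the weight would vanish almost everywhere, against the
    -- positivity of its integral.
    by_contra! hcon
    refine hpos.ne' (integral_eq_zero_of_ae ?_)
    filter_upwards [hall] with x hx
    by_contra h0
    obtain ⟨i, h1, h2⟩ := hcon x h0
    exact h2 (hx i h1)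
  obtain ⟨hinj, hwx⟩ := (betaWeight_ne_zero_iff hβ w x).1 hx0
  have hsum := integrable_finsetSum Finset.univ fun i _ => hx i
    ((betaWeight_ne_zero_iff hβ w _).2
      ⟨hinj.comp Fin.succAbove_right_injective, fun l => hwx _⟩)
  obtain ⟨C, hC⟩ := one_add_norm_pow_le_sum β (Subtype.val_injective.comp hinj)
  have hv : Measurable fun a : W => (a : 𝕜) := hW
  refine (hsum.const_mul C).mono'
    (((hv.norm.const_add 1).pow_const _).mul hw).aestronglyMeasurable
    (Filter.Eventually.of_forall fun a => ?_)
  rw [Real.norm_of_nonneg (mul_nonneg (by positivity) (hw0 a)), ← Finset.sum_mul, ← mul_assoc]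
  exact mul_le_mul_of_nonneg_right (hC a) (hw0 a)

end BetaWeight

/-! ### Removing the absolute values -/

section Phase

variable {𝕜 : Type*} [RCLike 𝕜] {W : Set 𝕜} {c : W → 𝕜}

/-- For distinct points the relation forces `‖c x‖ * ‖c y‖ = 1`; fixing `y` bounds `c` everywhere.
-/
theorem exists_norm_phase_le
    (hc : ∀ x y : W, ((‖(x : 𝕜) - (y : 𝕜)‖ ^ 2 : ℝ) : 𝕜) = c x * c y * ((x : 𝕜) - (y : 𝕜)) ^ 2) :
    ∃ C : ℝ, 0 ≤ C ∧ ∀ x, ‖c x‖ ≤ C := by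
  rcases isEmpty_or_nonempty W with h | ⟨⟨y⟩⟩
  · exact ⟨0, le_rfl, fun x => isEmptyElim x⟩
  refine ⟨‖c y‖ + ‖c y‖⁻¹, by positivity, fun x => ?_⟩
  rcases eq_or_ne x y with rfl | hxy
  · exact le_add_of_nonneg_right (by positivity)
  have hne : ‖(x : 𝕜) - y‖ ^ 2 ≠ 0 :=
    pow_ne_zero 2 (norm_ne_zero_iff.2 (sub_ne_zero.2 (Subtype.val_injective.ne hxy)))
  have h := congrArg norm (hc x y)
  rw [norm_mul, norm_mul, norm_pow, RCLike.norm_ofReal, abs_of_nonneg (by positivity)] at h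
  have h1 : ‖c x‖ * ‖c y‖ = 1 := mul_right_cancel₀ hne (by rw [one_mul]; exact h.symm)
  rw [eq_inv_of_mul_eq_one_left h1]
  exact le_add_of_nonneg_left (norm_nonneg _)

/-- Fixing `y`, the relation can be solved for `c x` at every `x ≠ y`, and points are measurable. -/
theorem measurable_phase [MeasurableSpace W] (hW : @Measurable W 𝕜 _ (borel 𝕜) Subtype.val)
    (hc : ∀ x y : W, ((‖(x : 𝕜) - (y : 𝕜)‖ ^ 2 : ℝ) : 𝕜) = c x * c y * ((x : 𝕜) - (y : 𝕜)) ^ 2) :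
    Measurable c := by
  classical
  have hv : Measurable fun a : W => (a : 𝕜) := hW
  rcases isEmpty_or_nonempty W with h | ⟨⟨y⟩⟩
  · exact Subsingleton.measurable
  have hsing : MeasurableSet {x : W | x = y} := by
    have : {x : W | x = y} = Subtype.val ⁻¹' {(y : 𝕜)} := by ext x; simp [Subtype.ext_iff]
    rw [this]
    exact hv (measurableSet_singleton _)
  have heq : c = fun x => if x = y then c y else
      ((‖(x : 𝕜) - (y : 𝕜)‖ ^ 2 : ℝ) : 𝕜) / (c y * ((x : 𝕜) - (y : 𝕜)) ^ 2) := by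
    funext x
    split_ifs with hxy
    · rw [hxy]
    · have hne : (x : 𝕜) - y ≠ 0 := sub_ne_zero.2 (Subtype.val_injective.ne hxy)
      have hcy : c y ≠ 0 := by
        intro h0
        have := hc x y
        rw [h0, mul_zero, zero_mul, RCLike.ofReal_eq_zero] at this
        exact hne (norm_eq_zero.1 (pow_eq_zero_iff two_ne_zero |>.1 this))
      rw [hc x y]
      field_simp
  rw [heq]
  refine Measurable.ite hsing measurable_const ?_
  have h1 : Measurable fun x : W => (x : 𝕜) - (y : 𝕜) := hv.sub_const _
  exact (RCLike.measurable_ofReal.comp (h1.norm.pow_const 2)).div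
    ((h1.pow_const 2).const_mul _)

theorem betaWeight_eq_prod_modifiedWeight
    (hc : ∀ x y : W, ((‖(x : 𝕜) - (y : 𝕜)‖ ^ 2 : ℝ) : 𝕜) = c x * c y * ((x : 𝕜) - (y : 𝕜)) ^ 2)
    {β : ℕ} (hβ : Even β) (w : W → ℝ) {M : ℕ} (x : Fin M → W) :
    ((betaWeight β w x : ℝ) : 𝕜) =
      (∏ j, ∏ k ∈ Finset.Ioi j, ((x k : 𝕜) - (x j : 𝕜)) ^ β) *
        ∏ l, modifiedWeight β M c w (x l) := by
  have hb : β = 2 * (β / 2) := (Nat.two_mul_div_two_of_even hβ).symm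
  have hpair : ∀ j k : Fin M, ((‖(x k : 𝕜) - (x j : 𝕜)‖ ^ β : ℝ) : 𝕜) =
      ((x k : 𝕜) - (x j : 𝕜)) ^ β * (c (x j) ^ (β / 2) * c (x k) ^ (β / 2)) := by
    intro j k
    conv_lhs => rw [hb, pow_mul, RCLike.ofReal_pow, hc]
    conv_rhs => rw [hb, pow_mul, ← hb]
    rw [mul_pow, mul_pow]
    ring
  simp only [betaWeight, RCLike.ofReal_mul, RCLike.ofReal_prod, hpair, Finset.prod_mul_distrib,
    modifiedWeight]
  rw [mul_assoc]
  congr 2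
  simp only [← Finset.prod_mul_distrib]
  rw [prod_Ioi_mul_eq_prod_pow fun l => c (x l) ^ (β / 2)]
  simp only [← pow_mul, mul_comm]

theorem betaWeight_append_eq
    (hc : ∀ x y : W, ((‖(x : 𝕜) - (y : 𝕜)‖ ^ 2 : ℝ) : 𝕜) = c x * c y * ((x : 𝕜) - (y : 𝕜)) ^ 2)
    {β : ℕ} (hβ : Even β) (w : W → ℝ) {m n : ℕ} (y : Fin m → W) (x : Fin n → W) :
    ((betaWeight β w (Fin.append y x) : ℝ) : 𝕜) =
      (∏ j, ∏ k ∈ Finset.Ioi j, ((y k : 𝕜) - (y j : 𝕜)) ^ β) *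
      (∏ l, modifiedWeight β (m + n) c w (y l)) *
      ((∏ l, ((∏ j, ((x l : 𝕜) - (y j : 𝕜)) ^ β) * modifiedWeight β (m + n) c w (x l))) *
        ∏ j, ∏ k ∈ Finset.Ioi j, ((x k : 𝕜) - (x j : 𝕜)) ^ β) := by
  rw [betaWeight_eq_prod_modifiedWeight hc hβ,
    prod_Ioi_append (fun a b : W => ((b : 𝕜) - (a : 𝕜)) ^ β), Fin.prod_univ_add]
  simp only [Fin.append_left, Fin.append_right]
  simp only [Finset.prod_mul_distrib]
  ring

variable [MeasurableSpace W] {w : W → ℝ} {μ : Measure W}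

theorem integrable_gramIntegrand (hW : @Measurable W 𝕜 _ (borel 𝕜) Subtype.val)
    (hc : ∀ x y : W, ((‖(x : 𝕜) - (y : 𝕜)‖ ^ 2 : ℝ) : 𝕜) = c x * c y * ((x : 𝕜) - (y : 𝕜)) ^ 2)
    (hw : Measurable w) (hw0 : ∀ x, 0 ≤ w x) {L m n : ℕ} (hL : 0 < L)
    (hmom : Integrable (fun x : W => (1 + ‖(x : 𝕜)‖) ^ (L ^ 2 * (m + n - 1)) * w x) μ)
    {p : Fin (L * n) → Polynomial 𝕜} (hp : IsCompleteMonicFamily p) (y : Fin m → W)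
    (t : Set.powersetCard (Fin (L * n)) L) :
    Integrable (gramIntegrand (L ^ 2) (modifiedWeight (L ^ 2) (m + n) c w) p y t) μ := by
  have hv : Measurable fun a : W => (a : 𝕜) := hW
  obtain ⟨q, hqdeg, hq⟩ := exists_wronskian_eq_eval (fun k => (hp k).2.le) t
  obtain ⟨C, hC0, hC⟩ := exists_norm_eval_le hqdeg
  obtain ⟨D, hD0, hD⟩ := exists_norm_phase_le hc
  -- The `L`-subset `t` exists only if `n ≥ 1`; the exponent identity below needs this because of
  -- truncated subtraction.
  have hn : 1 ≤ n := by
    have hle : L ≤ L * n := by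
      simpa using Fintype.card_le_of_injective _ (Set.powersetCard.ofFinEmbEquiv.symm t).injective
    exact Nat.pos_of_ne_zero fun h => by simp [h] at hle; omega
  -- The degree of the factors in `y` plus the degree bound of the Wronskian is exactly the order of
  -- the available moment.
  have hexp : L ^ 2 * (m + n - 1) = L ^ 2 * m + L * (L * n - L) := by
    obtain ⟨k, rfl⟩ : ∃ k, n = k + 1 := ⟨n - 1, by omega⟩
    have : L * (k + 1) - L = L * k := by rw [mul_add, mul_one, Nat.add_sub_cancel]
    rw [this, ← add_assoc, Nat.add_sub_cancel]
    ring
  set E := (m + n - 1) * (L ^ 2 / 2) with hE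
  have hbound : ∀ x : W, ‖gramIntegrand (L ^ 2) (modifiedWeight (L ^ 2) (m + n) c w) p y t x‖ ≤
      ((∏ j, (1 + ‖(y j : 𝕜)‖) ^ (L ^ 2)) * C * D ^ E) *
        ((1 + ‖(x : 𝕜)‖) ^ (L ^ 2 * (m + n - 1)) * w x) := by
    intro x
    rw [gramIntegrand, modifiedWeight, ← hE, norm_mul, norm_mul, norm_mul, norm_prod, hq, norm_pow,
      RCLike.norm_ofReal, abs_of_nonneg (hw0 x), hexp, pow_add]
    have h1 : ∏ j, ‖((x : 𝕜) - (y j : 𝕜)) ^ (L ^ 2)‖ ≤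
        (∏ j, (1 + ‖(y j : 𝕜)‖) ^ (L ^ 2)) * (1 + ‖(x : 𝕜)‖) ^ (L ^ 2 * m) := by
      have h : ∏ j, ‖((x : 𝕜) - (y j : 𝕜)) ^ (L ^ 2)‖ ≤
          ∏ j : Fin m, ((1 + ‖(y j : 𝕜)‖) * (1 + ‖(x : 𝕜)‖)) ^ (L ^ 2) :=
        Finset.prod_le_prod (fun _ _ => norm_nonneg _) fun j _ => by
          rw [norm_pow]
          exact pow_le_pow_left₀ (norm_nonneg _) (norm_sub_le_one_add_mul _ _) _
      simpa only [mul_pow, Finset.prod_mul_distrib, Finset.prod_const, Finset.card_univ,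
        Fintype.card_fin, ← pow_mul] using h
    calc _ ≤ ((∏ j, (1 + ‖(y j : 𝕜)‖) ^ (L ^ 2)) * (1 + ‖(x : 𝕜)‖) ^ (L ^ 2 * m)) *
          (C * (1 + ‖(x : 𝕜)‖) ^ (L * (L * n - L))) * (D ^ E * w x) := by
          have := hC (x : 𝕜)
          have := hD x
          have := hw0 x
          gcongr
      _ = _ := by ring
  refine (hmom.const_mul _).mono' ?_ (Filter.Eventually.of_forall hbound)
  have hmeas : Measurable (gramIntegrand (L ^ 2) (modifiedWeight (L ^ 2) (m + n) c w) p y t) := by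
    refine Measurable.mul (Measurable.mul ?_ ?_) (Measurable.mul ?_ ?_)
    · exact Finset.measurable_prod _ fun j _ => (hv.sub_const _).pow_const _
    · simp only [hq]
      exact q.continuous.measurable.comp hv
    · exact (measurable_phase hW hc).pow_const _
    · exact RCLike.measurable_ofReal.comp hw
  exact hmeas.aestronglyMeasurable

theorem integrable_betaWeight_append (hW : @Measurable W 𝕜 _ (borel 𝕜) Subtype.val)
    [SigmaFinite μ] (hw : Measurable w) (hw0 : ∀ x, 0 ≤ w x) {β m n : ℕ}
    (hmom : Integrable (fun x : W => (1 + ‖(x : 𝕜)‖) ^ (β * (m + n - 1)) * w x) μ)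
    (y : Fin m → W) :
    Integrable (fun x : Fin n → W => betaWeight β w (Fin.append y x)) (Measure.pi fun _ => μ) := by
  have happ : Measurable fun x : Fin n → W => Fin.append y x := by
    refine measurable_pi_iff.2 fun i => ?_
    refine Fin.addCases (fun j => ?_) (fun j => ?_) i
    · simp only [Fin.append_left]; exact measurable_const
    · simp only [Fin.append_right]; exact measurable_pi_apply j
  have hprod := Integrable.fintype_prod (ι := Fin n)
    (f := fun _ (x : W) => (1 + ‖(x : 𝕜)‖) ^ (β * (m + n - 1)) * w x) fun _ => hmom
  refine (hprod.const_mul (∏ l, ((1 + ‖(y l : 𝕜)‖) ^ (β * (m + n - 1)) * w (y l)))).mono'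
    ((measurable_betaWeight hW β hw _).comp happ).aestronglyMeasurable
    (Filter.Eventually.of_forall fun x => ?_)
  rw [Real.norm_of_nonneg (betaWeight_nonneg β hw0 _)]
  refine (betaWeight_le_prod β hw0 _).trans_eq ?_
  rw [Fin.prod_univ_add]
  simp only [Fin.append_left, Fin.append_right]

theorem betaCorrelation_eq_hyperpfaffianCorrelation
    (hW : @Measurable W 𝕜 _ (borel 𝕜) Subtype.val)
    (hc : ∀ x y : W, ((‖(x : 𝕜) - (y : 𝕜)‖ ^ 2 : ℝ) : 𝕜) = c x * c y * ((x : 𝕜) - (y : 𝕜)) ^ 2)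
    [SigmaFinite μ] (hw : Measurable w) (hw0 : ∀ x, 0 ≤ w x) {L m n : ℕ} (hL : 0 < L) (hLe : Even L)
    (hmom : Integrable (fun x : W => (1 + ‖(x : 𝕜)‖) ^ (L ^ 2 * (m + n - 1)) * w x) μ)
    {p : Fin (L * n) → Polynomial 𝕜} (hp : IsCompleteMonicFamily p) (y : Fin m → W) :
    (betaCorrelation (L ^ 2) w μ m n y : 𝕜) = hyperpfaffianCorrelation L c w μ m n p y := by
  have hβ : Even (L ^ 2) := hLe.pow_of_ne_zero two_ne_zero
  set u := modifiedWeight (L ^ 2) (m + n) c w with hu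
  have hgram : ∀ t : Set.powersetCard (Fin (L * n)) L, gramIntegrand (L ^ 2) u p y t =
      fun x : W => ((∏ j, ((x : 𝕜) - (y j : 𝕜)) ^ (L ^ 2)) * u x) * wronskian p t (x : 𝕜) := by
    intro t
    funext x
    rw [gramIntegrand, mul_right_comm]
  have hpf := hyperpfaffian_sum_integral_wronskian μ hp (fun x : W => (x : 𝕜))
    (fun x : W => (∏ j, ((x : 𝕜) - (y j : 𝕜)) ^ (L ^ 2)) * u x) fun t => by
      rw [← hgram t]
      exact integrable_gramIntegrand hW hc hw hw0 hL hmom hp y t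
  rw [hyperpfaffianCorrelation, ← hu, gramVector]
  simp only [hgram]
  rw [hpf, betaCorrelation]
  simp only [jointDensity]
  rw [integral_const_mul, RCLike.ofReal_mul, RCLike.ofReal_mul, ← integral_ofReal]
  simp only [betaWeight_append_eq hc hβ]
  rw [integral_const_mul, ← hu]
  have hfac : ((m + n)! : 𝕜) ≠ 0 := Nat.cast_ne_zero.2 (Nat.factorial_ne_zero _)
  push_cast
  rw [mul_inv, div_eq_mul_inv]
  field_simp

end Phase

/-! ### Correlation functions of symmetric densities -/

section CorrelationOfSymmetric

variable {X : Type*}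

theorem prod_occupation_eq_sum {M m : ℕ} (B : Fin m → Set X) (x : Fin M → X) :
    ∏ i, (occupation (B i) x : ℝ≥0∞) =
      ∑ σ : Fin m → Fin M, ∏ i, (B i).indicator 1 (x (σ i)) := by
  classical
  have h : ∀ i, (occupation (B i) x : ℝ≥0∞) = ∑ j, (B i).indicator 1 (x j) := by
    intro i
    simp [occupation, Set.indicator_apply, Finset.sum_boole]
  simp only [h]
  rw [Finset.prod_univ_sum, Fintype.piFinset_univ]

/-- One particle cannot lie in two disjoint sets, so only `m`-tuples of distinct particles
contribute. -/
theorem prod_indicator_eq_zero_of_not_injective {M m : ℕ} {B : Fin m → Set X}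
    (hB : Pairwise fun i j => Disjoint (B i) (B j)) (x : Fin M → X) {σ : Fin m → Fin M}
    (hσ : ¬ Function.Injective σ) :
    ∏ i, (B i).indicator (1 : X → ℝ≥0∞) (x (σ i)) = 0 := by
  simp only [Function.Injective, not_forall] at hσ
  obtain ⟨i, j, hij, hne⟩ := hσ
  by_cases h : x (σ i) ∈ B i
  · have h' : x (σ j) ∉ B j := by
      rw [← hij]
      exact Set.disjoint_left.1 (hB hne) h
    exact Finset.prod_eq_zero (Finset.mem_univ j) (Set.indicator_of_notMem h' _)
  · exact Finset.prod_eq_zero (Finset.mem_univ i) (Set.indicator_of_notMem h _)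

variable [MeasurableSpace X] (μ : Measure X) [SigmaFinite μ]

theorem measurable_finAppend (m n : ℕ) :
    Measurable fun q : (Fin m → X) × (Fin n → X) => Fin.append q.1 q.2 := by
  refine measurable_pi_iff.2 fun i => ?_
  refine Fin.addCases (fun j => ?_) (fun j => ?_) i
  · simp only [Fin.append_left]
    exact (measurable_pi_apply j).comp measurable_fst
  · simp only [Fin.append_right]
    exact (measurable_pi_apply j).comp measurable_snd

theorem measurePreserving_finAppend (m n : ℕ) :
    MeasurePreserving (fun q : (Fin m → X) × (Fin n → X) => Fin.append q.1 q.2)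
      ((Measure.pi fun _ => μ).prod (Measure.pi fun _ => μ)) (Measure.pi fun _ => μ) := by
  refine ⟨measurable_finAppend m n, (Measure.pi_eq fun s hs => ?_).symm⟩
  rw [Measure.map_apply (measurable_finAppend m n) (MeasurableSet.univ_pi hs)]
  have h : (fun q : (Fin m → X) × (Fin n → X) => Fin.append q.1 q.2) ⁻¹' Set.univ.pi s =
      (Set.univ.pi fun i => s (Fin.castAdd n i)) ×ˢ (Set.univ.pi fun i => s (Fin.natAdd m i)) := by
    ext q
    simp only [Set.mem_preimage, Set.mem_univ_pi, Set.mem_prod]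
    refine ⟨fun h => ⟨fun i => ?_, fun i => ?_⟩, fun h i => ?_⟩
    · simpa using h (Fin.castAdd n i)
    · simpa using h (Fin.natAdd m i)
    · refine Fin.addCases (fun j => ?_) (fun j => ?_) i
      · simpa using h.1 j
      · simpa using h.2 j
  rw [h, Measure.prod_prod, Measure.pi_pi, Measure.pi_pi, Fin.prod_univ_add]

theorem measurePreserving_comp_perm {ι : Type*} [Fintype ι] (τ : Equiv.Perm ι) :
    MeasurePreserving (fun x : ι → X => x ∘ τ) (Measure.pi fun _ => μ) (Measure.pi fun _ => μ) := by
  have hm : Measurable fun x : ι → X => x ∘ τ :=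
    measurable_pi_iff.2 fun i => measurable_pi_apply (τ i)
  refine ⟨hm, (Measure.pi_eq fun s hs => ?_).symm⟩
  rw [Measure.map_apply hm (MeasurableSet.univ_pi hs)]
  have h : (fun x : ι → X => x ∘ τ) ⁻¹' Set.univ.pi s = Set.univ.pi fun i => s (τ.symm i) := by
    ext x
    simp only [Set.mem_preimage, Set.mem_univ_pi, Function.comp_apply]
    exact ⟨fun h i => by simpa using h (τ.symm i), fun h i => by simpa using h (τ i)⟩
  rw [h, Measure.pi_pi]
  exact Equiv.prod_comp τ.symm fun i => μ (s i)

theorem exists_perm_castAdd_eq {m n : ℕ} {σ : Fin m → Fin (m + n)} (hσ : Function.Injective σ) :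
    ∃ τ : Equiv.Perm (Fin (m + n)), ∀ i, τ (Fin.castAdd n i) = σ i := by
  classical
  let e₁ := Equiv.ofInjective (Fin.castAdd n : Fin m → Fin (m + n)) (Fin.castAdd_injective m n)
  let e₂ := Equiv.ofInjective σ hσ
  refine ⟨(e₁.symm.trans e₂).extendSubtype, fun i => ?_⟩
  rw [Equiv.extendSubtype_apply_of_mem _ _ ⟨i, rfl⟩]
  have : e₁.symm ⟨Fin.castAdd n i, ⟨i, rfl⟩⟩ = i := Equiv.ofInjective_symm_apply _ i
  simp [this, e₂]

/-- The factorial moments of a process with a symmetric density are integrals of the marginals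
of the density. -/
theorem lintegral_prod_occupation {m n : ℕ} {F : (Fin (m + n) → X) → ℝ≥0∞} (hF : Measurable F)
    (hsymm : ∀ (τ : Equiv.Perm (Fin (m + n))) x, F (x ∘ τ) = F x) {B : Fin m → Set X}
    (hBm : ∀ i, MeasurableSet (B i)) (hB : Pairwise fun i j => Disjoint (B i) (B j)) :
    ∫⁻ x, ∏ i, (occupation (B i) x : ℝ≥0∞) ∂((Measure.pi fun _ => μ).withDensity F) =
      ∫⁻ y in Set.univ.pi B, ((m + n).descFactorial m : ℝ≥0∞) *
        ∫⁻ x : Fin n → X, F (Fin.append y x) ∂(Measure.pi fun _ => μ) ∂(Measure.pi fun _ => μ) := by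
  classical
  have hind : ∀ {M : ℕ} (σ : Fin m → Fin M),
      Measurable fun x : Fin M → X => ∏ i, (B i).indicator (1 : X → ℝ≥0∞) (x (σ i)) := fun σ =>
    Finset.measurable_prod _ fun i _ =>
      (measurable_one.indicator (hBm i)).comp (measurable_pi_apply (σ i))
  have hFind : ∀ σ : Fin m → Fin (m + n), Measurable fun x : Fin (m + n) → X =>
      F x * ∏ i, (B i).indicator (1 : X → ℝ≥0∞) (x (σ i)) := fun σ => hF.mul (hind σ)
  set I := ∫⁻ x, F x * ∏ i, (B i).indicator 1 (x (Fin.castAdd n i)) ∂(Measure.pi fun _ => μ)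
  -- By symmetry of `F`, any choice of distinct particles may be relabelled as the first `m`; the
  -- number of choices gives the falling factorial.
  have hσ : ∀ σ : Fin m → Fin (m + n),
      ∫⁻ x, F x * ∏ i, (B i).indicator 1 (x (σ i)) ∂(Measure.pi fun _ => μ) =
        if Function.Injective σ then I else 0 := by
    intro σ
    split_ifs with h
    · obtain ⟨τ, hτ⟩ := exists_perm_castAdd_eq h
      refine Eq.trans (lintegral_congr fun x => ?_)
        ((measurePreserving_comp_perm μ τ).lintegral_comp (hFind (Fin.castAdd n)))
      simp only [hsymm, Function.comp_apply, hτ]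
    · simp [prod_indicator_eq_zero_of_not_injective hB _ h]
  have hI : I = ∫⁻ y in Set.univ.pi B, ∫⁻ x : Fin n → X, F (Fin.append y x)
      ∂(Measure.pi fun _ => μ) ∂(Measure.pi fun _ => μ) := by
    refine ((measurePreserving_finAppend μ m n).lintegral_comp
      (hFind (Fin.castAdd n))).symm.trans ?_
    refine (lintegral_prod _
      ((hFind (Fin.castAdd n)).comp (measurable_finAppend m n)).aemeasurable).trans ?_
    rw [← lintegral_indicator (MeasurableSet.univ_pi hBm)]
    refine lintegral_congr fun y => ?_
    simp only [Function.comp_apply, Fin.append_left]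
    have hFy : Measurable fun x : Fin n → X => F (Fin.append y x) :=
      hF.comp ((measurable_finAppend m n).comp measurable_prodMk_left)
    rw [lintegral_mul_const _ hFy]
    by_cases hy : y ∈ Set.univ.pi B
    · rw [Set.indicator_of_mem hy, Finset.prod_eq_one, mul_one]
      intro i _
      exact Set.indicator_of_mem (hy i (Set.mem_univ i)) _
    · rw [Set.indicator_of_notMem hy]
      simp only [Set.mem_univ_pi, not_forall] at hy
      obtain ⟨i, hi⟩ := hy
      rw [Finset.prod_eq_zero (Finset.mem_univ i) (Set.indicator_of_notMem hi _), mul_zero]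
  have hcard : (Finset.univ.filter fun σ : Fin m → Fin (m + n) => Function.Injective σ).card =
      (m + n).descFactorial m := by
    rw [← Fintype.card_subtype, Fintype.card_congr (Equiv.subtypeInjectiveEquivEmbedding _ _),
      Fintype.card_embedding_eq, Fintype.card_fin, Fintype.card_fin]
  have hmeasF : Measurable fun y : Fin m → X =>
      ∫⁻ x : Fin n → X, F (Fin.append y x) ∂(Measure.pi fun _ => μ) :=
    (hF.comp (measurable_finAppend m n)).lintegral_prod_right'
  simp only [prod_occupation_eq_sum]
  rw [lintegral_withDensity_eq_lintegral_mul _ hF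
    (Finset.measurable_sum _ fun σ _ => hind σ)]
  simp only [Pi.mul_apply, Finset.mul_sum]
  rw [lintegral_finsetSum _ fun σ _ => hFind σ]
  simp only [hσ]
  rw [← Finset.sum_filter, Finset.sum_const, hcard, nsmul_eq_mul, hI, lintegral_const_mul _ hmeasF]

end CorrelationOfSymmetric

/-! ### Uniqueness off the diagonals -/

section Uniqueness

variable {X : Type*} [MeasurableSpace X] {μ : Measure X}

theorem lintegral_prod_occupation_lt_top {M m : ℕ} (P : Measure (Fin M → X)) [IsFiniteMeasure P]
    (B : Fin m → Set X) : ∫⁻ x, ∏ i, (occupation (B i) x : ℝ≥0∞) ∂P < ∞ := by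
  have h : ∀ x : Fin M → X, ∏ i, (occupation (B i) x : ℝ≥0∞) ≤ (M : ℝ≥0∞) ^ m := by
    intro x
    refine (Finset.prod_le_prod' (g := fun _ => (M : ℝ≥0∞)) fun i _ => ?_).trans_eq (by simp)
    have : occupation (B i) x ≤ M := (Finset.card_le_univ _).trans_eq (by simp)
    exact_mod_cast this
  refine (lintegral_mono h).trans_lt ?_
  rw [lintegral_const]
  exact ENNReal.mul_lt_top (ENNReal.pow_lt_top (ENNReal.natCast_lt_top M)) (measure_lt_top _ _)

/-- Shrinking the sides of a box keeps them disjoint. Both densities thus give finite measures on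
the box that agree on the π-system of sub-boxes. -/
theorem IsCorrelationFunction.ae_eq_on_pi {M m : ℕ} {P : Measure (Fin M → X)} [IsFiniteMeasure P]
    {R S : (Fin m → X) → ℝ} (hR : IsCorrelationFunction μ P m R)
    (hS : IsCorrelationFunction μ P m S) {B : Fin m → Set X} (hBm : ∀ i, MeasurableSet (B i))
    (hB : Pairwise fun i j => Disjoint (B i) (B j)) :
    ∀ᵐ y ∂(Measure.pi fun _ => μ), y ∈ Set.univ.pi B → R y = S y := by
  set ν := (Measure.pi fun _ : Fin m => μ).restrict (Set.univ.pi B) with hν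
  have hbox : ∀ T : (Fin m → X) → ℝ, IsCorrelationFunction μ P m T → ∀ C : Fin m → Set X,
      (∀ i, MeasurableSet (C i)) → ν.withDensity (fun y => ENNReal.ofReal (T y)) (Set.univ.pi C) =
        ∫⁻ x, ∏ i, (occupation (C i ∩ B i) x : ℝ≥0∞) ∂P := by
    intro T hT C hC
    rw [withDensity_apply _ (MeasurableSet.univ_pi hC), hν,
      Measure.restrict_restrict (MeasurableSet.univ_pi hC), ← Set.pi_inter_distrib]
    exact (hT.expectation _ (fun i => (hC i).inter (hBm i)) fun i j hij =>
      (hB hij).mono Set.inter_subset_right Set.inter_subset_right).symm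
  have huniv : ∀ T : (Fin m → X) → ℝ, IsCorrelationFunction μ P m T →
      ν.withDensity (fun y => ENNReal.ofReal (T y)) Set.univ =
        ∫⁻ x, ∏ i, (occupation (B i) x : ℝ≥0∞) ∂P := by
    intro T hT
    have := hbox T hT (fun _ => Set.univ) fun _ => MeasurableSet.univ
    simpa only [Set.pi_univ, Set.univ_inter] using this
  have hfin : ν.withDensity (fun y => ENNReal.ofReal (R y)) Set.univ < ∞ := by
    rw [huniv R hR]
    exact lintegral_prod_occupation_lt_top P B
  have : IsFiniteMeasure (ν.withDensity fun y => ENNReal.ofReal (R y)) := ⟨hfin⟩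
  have heq : ν.withDensity (fun y => ENNReal.ofReal (R y)) =
      ν.withDensity fun y => ENNReal.ofReal (S y) := by
    refine ext_of_generate_finite _ generateFrom_pi.symm isPiSystem_pi ?_ ?_
    · rintro _ ⟨C, hC, rfl⟩
      have hC' : ∀ i, MeasurableSet (C i) := fun i => hC i (Set.mem_univ i)
      rw [hbox R hR C hC', hbox S hS C hC']
    · rw [huniv R hR, huniv S hS]
  rw [withDensity_eq_iff hR.measurable.ennreal_ofReal.aemeasurable
    hS.measurable.ennreal_ofReal.aemeasurable
    (by rw [← setLIntegral_univ, ← withDensity_apply _ MeasurableSet.univ]; exact hfin.ne)] at heq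
  have heq' := (ae_restrict_iff' (MeasurableSet.univ_pi hBm)).1 heq
  filter_upwards [heq'] with y hy hyB
  exact (ENNReal.ofReal_eq_ofReal_iff (hR.nonneg y) (hS.nonneg y)).1 (hy hyB)

/-- Distinct points are separated by disjoint basic open sets. A countable base yields countably
many boxes, so their exceptional null sets can be united. -/
theorem IsCorrelationFunction.ae_eq_of_injective {E : Type*} [TopologicalSpace E] [T2Space E]
    [SecondCountableTopology E] [MeasurableSpace E] [OpensMeasurableSpace E] {ξ : X → E}
    (hξ : Measurable ξ) (hinj : Function.Injective ξ) {M m : ℕ} {P : Measure (Fin M → X)}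
    [IsFiniteMeasure P] {R S : (Fin m → X) → ℝ} (hR : IsCorrelationFunction μ P m R)
    (hS : IsCorrelationFunction μ P m S) :
    ∀ᵐ y ∂(Measure.pi fun _ => μ), Function.Injective y → R y = S y := by
  have hcount : Countable (TopologicalSpace.countableBasis E) :=
    (TopologicalSpace.countable_countableBasis E).to_subtype
  have hae : ∀ᵐ y ∂(Measure.pi fun _ => μ), ∀ b : Fin m → TopologicalSpace.countableBasis E,
      (Pairwise fun i j => Disjoint (b i : Set E) (b j)) →
      y ∈ Set.univ.pi (fun i => ξ ⁻¹' (b i : Set E)) → R y = S y := by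
    refine ae_all_iff.2 fun b => ?_
    by_cases hb : Pairwise fun i j => Disjoint (b i : Set E) (b j)
    · have hopen : ∀ i, MeasurableSet (b i : Set E) := fun i =>
        (TopologicalSpace.isOpen_of_mem_countableBasis (b i).2).measurableSet
      filter_upwards [hR.ae_eq_on_pi hS (fun i => hξ (hopen i))
        fun i j hij => (hb hij).preimage ξ] with y hy _ using hy
    · exact Filter.Eventually.of_forall fun y h => absurd h hb
  filter_upwards [hae] with y hy hyinj
  have hyinj' : Function.Injective fun i => ξ (y i) := hinj.comp hyinj
  obtain ⟨U, hU, hdisj⟩ := (Set.finite_range fun i => ξ (y i)).t2_separation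
  have hex : ∀ i, ∃ v : TopologicalSpace.countableBasis E, ξ (y i) ∈ (v : Set E) ∧
      (v : Set E) ⊆ U (ξ (y i)) := by
    intro i
    obtain ⟨v, hv, h1, h2⟩ := (TopologicalSpace.isBasis_countableBasis E).exists_subset_of_mem_open
      (hU (ξ (y i))).1 (hU (ξ (y i))).2
    exact ⟨⟨v, hv⟩, h1, h2⟩
  choose b hb1 hb2 using hex
  refine hy b (fun i j hij => ?_) fun i _ => hb1 i
  exact (hdisj ⟨i, rfl⟩ ⟨j, rfl⟩ (hyinj'.ne hij)).mono (hb2 i) (hb2 j)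

end Uniqueness

/-! ### The marginal density as a correlation function -/

section BetaEnsemble

variable {𝕜 : Type*} [RCLike 𝕜] {W : Set 𝕜} [MeasurableSpace W] {w : W → ℝ} {μ : Measure W}

theorem isFiniteMeasure_betaEnsemble {β M : ℕ}
    (hint : Integrable (fun x : Fin M → W => betaWeight β w x) (Measure.pi fun _ => μ)) :
    IsFiniteMeasure (betaEnsemble β w μ M) :=
  isFiniteMeasure_withDensity_ofReal (hint.const_mul _).2

theorem isCorrelationFunction_betaCorrelation [SigmaFinite μ]
    (hW : @Measurable W 𝕜 _ (borel 𝕜) Subtype.val) (hw : Measurable w) (hw0 : ∀ x, 0 ≤ w x)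
    {β m n : ℕ} (hZ : 0 ≤ partitionFunction β w μ (m + n))
    (hint : ∀ y : Fin m → W, Integrable (fun x : Fin n → W => jointDensity β w μ (Fin.append y x))
      (Measure.pi fun _ => μ)) :
    IsCorrelationFunction μ (betaEnsemble β w μ (m + n)) m (betaCorrelation β w μ m n) := by
  have hf : Measurable fun x : Fin (m + n) → W => jointDensity β w μ x :=
    (measurable_betaWeight hW β hw _).const_mul _
  have hf0 : ∀ x : Fin (m + n) → W, 0 ≤ jointDensity β w μ x := fun x =>
    mul_nonneg (inv_nonneg.2 (mul_nonneg (Nat.cast_nonneg _) hZ)) (betaWeight_nonneg β hw0 x)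
  refine ⟨?_, fun y => ?_, fun B hBm hB => ?_⟩
  · exact ((hf.comp (measurable_finAppend m n)).stronglyMeasurable.integral_prod_right'
      ).measurable.const_mul _
  · exact mul_nonneg (by positivity) (integral_nonneg fun x => hf0 _)
  · rw [betaEnsemble, lintegral_prod_occupation μ hf.ennreal_ofReal (fun τ x => by
      rw [jointDensity, jointDensity, betaWeight_comp_perm]) hBm hB]
    refine lintegral_congr fun y => ?_
    rw [betaCorrelation, ENNReal.ofReal_mul (by positivity),
      ofReal_integral_eq_lintegral_ofReal (hint y) (Filter.Eventually.of_forall fun x => hf0 _)]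
    congr 1
    have h : ((m + n)! : ℝ) / (n ! : ℝ) = ((m + n).descFactorial m : ℝ) := by
      rw [div_eq_iff (Nat.cast_ne_zero.2 (Nat.factorial_ne_zero n))]
      have := Nat.factorial_mul_descFactorial (Nat.le_add_right m n)
      rw [Nat.add_sub_cancel_left, mul_comm] at this
      exact_mod_cast this.symm
    rw [h, ENNReal.ofReal_natCast]

end BetaEnsemble

end

/-! ### The hyperpfaffian formula -/

theorem mainTheorem1 {𝕜 : Type*} [RCLike 𝕜] {W : Set 𝕜} [MeasurableSpace W]
    -- the σ-algebra of `W` contains the Borel sets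
    (hW : @Measurable W 𝕜 _ (borel 𝕜) Subtype.val)
    (μ : Measure W) [SigmaFinite μ]
    (c : W → 𝕜)
    (hc : ∀ x y : W, ((‖(x : 𝕜) - (y : 𝕜)‖ ^ 2 : ℝ) : 𝕜) = c x * c y * ((x : 𝕜) - (y : 𝕜)) ^ 2)
    (w : W → ℝ) (hw : Measurable w) (hw0 : ∀ x, 0 ≤ w x)
    -- charge `L`, `β = L ^ 2`, and `M = m + M'` particles
    (L : ℕ) (hL : Even L) (hLpos : 0 < L) (m M' : ℕ) (hm : 1 ≤ m)
    -- `0 < Z < ∞`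
    (hZfin : Integrable (fun x : Fin (m + M') → W => betaWeight (L ^ 2) w x)
      (Measure.pi fun _ => μ))
    (hZpos : 0 < partitionFunction (L ^ 2) w μ (m + M'))
    (p : Fin (L * M') → Polynomial 𝕜) (hp : IsCompleteMonicFamily p) :
    -- all the integrals converge
    (∀ y : Fin m → W,
      Integrable (fun x : Fin M' → W => jointDensity (L ^ 2) w μ (Fin.append y x))
        (Measure.pi fun _ => μ) ∧
      ∀ t : Set.powersetCard (Fin (L * M')) L,
        Integrable (gramIntegrand (L ^ 2) (modifiedWeight (L ^ 2) (m + M') c w) p y t) μ) ∧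
    -- the marginal density is an `m`-th correlation function and is given by the hyperpfaffian
    IsCorrelationFunction μ (betaEnsemble (L ^ 2) w μ (m + M')) m
      (betaCorrelation (L ^ 2) w μ m M') ∧
    (∀ y : Fin m → W,
      (betaCorrelation (L ^ 2) w μ m M' y : 𝕜) = hyperpfaffianCorrelation L c w μ m M' p y) ∧
    -- every `m`-th correlation function is given by the hyperpfaffian, almost everywhere on the
    -- configurations of distinct points (the only ones that its definition sees)
    (∀ R : (Fin m → W) → ℝ,
      IsCorrelationFunction μ (betaEnsemble (L ^ 2) w μ (m + M')) m R →
      ∀ᵐ y ∂(Measure.pi fun _ => μ), Function.Injective y →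
        (R y : 𝕜) = hyperpfaffianCorrelation L c w μ m M' p y) := by
  have hint0 : 0 < ∫ x : Fin (m + M') → W, betaWeight (L ^ 2) w x ∂(Measure.pi fun _ => μ) :=
    pos_of_mul_pos_right hZpos (by positivity)
  have hmom := integrable_one_add_norm_pow_mul_weight hW μ (pow_ne_zero 2 hLpos.ne') hw hw0
    (by omega) hZfin hint0
  have hjoint : ∀ y : Fin m → W,
      Integrable (fun x : Fin M' → W => jointDensity (L ^ 2) w μ (Fin.append y x))
        (Measure.pi fun _ => μ) := fun y =>
    (integrable_betaWeight_append hW hw hw0 hmom y).const_mul _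
  have hcorr := isCorrelationFunction_betaCorrelation hW hw hw0 hZpos.le hjoint
  have heq := betaCorrelation_eq_hyperpfaffianCorrelation hW hc hw hw0 hLpos hL hmom hp
  refine ⟨fun y => ⟨hjoint y, fun t => integrable_gramIntegrand hW hc hw hw0 hLpos hmom hp y t⟩,
    hcorr, heq, fun R hR => ?_⟩
  have := isFiniteMeasure_betaEnsemble hZfin
  have hv : Measurable fun a : W => (a : 𝕜) := hW
  filter_upwards [hR.ae_eq_of_injective hv Subtype.val_injective hcorr] with y hy hyinj
  rw [hy hyinj, heq]
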